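/- Let $\mathbb{L}_{\ge 0}$ be the closed long ray, i.e. $\omega_1\times[0,1)$ with the topology of the lexicographic order, and let $0$ denote its least element. A surface is a Hausdorff space in which each point has a neighbourhood homeomorphic to $\mathbb{R}\times\mathbb{R}_{\ge 0}$; its boundary $\partial M$ is the set of points having no neighbourhood homeomorphic to $\mathbb{R}^2$. A closed subset $B$ of a space $X$ is collared in $X$ if there is an embedding $h:B\times[0,1]\to X$ such that $h(x,0)=x$ for all $x\in B$, $h^{-1}(B)=B\times\{0\}$, and $h(B\times[0,1))$ is open in $X$. The closed octant $\mathbb{O}=\{(x,y)\in(\mathbb{L}_{\ge 0})^2 : y\le x\}$, with the subspace topology of the product, is a normal (Hausdorff) surface. Its boundary is the union of the diagonal and the horizontal axis, $\partial\mathbb{O}=\{(x,x):x\in\mathbb{L}_{\ge 0}\}\cup\{(x,0):x\in\mathbb{L}_{\ge 0}\}$, and $\partial\mathbb{O}$ is not collared in $\mathbb{O}$. The diagonal alone is not collared in $\mathbb{O}$ either. -/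

import Mathlib

open Set Topology

/-- The closed long ray `𝕃_{≥0} = ω₁ × [0,1)`, ordered lexicographically. -/
def LongRay : Type 1 :=
  (Set.Iio (Ordinal.omega 1 : Ordinal.{0})) ×ₗ (Set.Ico (0 : ℝ) 1)

noncomputable instance instLinearOrderLongRay : LinearOrder LongRay :=
  inferInstanceAs
    (LinearOrder ((Set.Iio (Ordinal.omega 1 : Ordinal.{0})) ×ₗ (Set.Ico (0 : ℝ) 1)))

/-- The long ray carries the order topology. -/
noncomputable instance instTopologicalSpaceLongRay : TopologicalSpace LongRay :=
  Preorder.topology LongRay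

instance instOrderTopologyLongRay : OrderTopology LongRay := ⟨rfl⟩

/-- A (topological) surface, possibly with boundary: a Hausdorff space in which every point has a
neighbourhood homeomorphic to `ℝ × ℝ_{≥0}`. Neither metrisability nor connectedness is assumed. -/
def IsSurface (M : Type*) [TopologicalSpace M] : Prop :=
  T2Space M ∧ ∀ x : M, ∃ N ∈ 𝓝 x, Nonempty (N ≃ₜ ℝ × Set.Ici (0 : ℝ))

/-- The boundary `∂M` of a surface `M`: the points that have no neighbourhood homeomorphic
to `ℝ²`. -/
def surfaceBoundary (M : Type*) [TopologicalSpace M] : Set M :=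
  {x | ¬ ∃ N ∈ 𝓝 x, Nonempty (N ≃ₜ ℝ × ℝ)}

/-- A (closed) subset `B` of a space `X` is collared in `X` if there is an embedding
`h : B × [0,1] → X` with `h (x, 0) = x` for all `x ∈ B`, with `h ⁻¹ (B) = B × {0}`, and such that
the image of `B × [0,1)` is open in `X`. -/
def IsCollared {X : Type*} [TopologicalSpace X] (B : Set X) : Prop :=
  ∃ h : B × Set.Icc (0 : ℝ) 1 → X,
    IsEmbedding h ∧
    (∀ x : B, h (x, ⟨0, by norm_num⟩) = x) ∧
    h ⁻¹' B = {p | (p.2 : ℝ) = 0} ∧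
    IsOpen (h '' {p | (p.2 : ℝ) < 1})

/-- The closed octant `{(x, y) ∈ (𝕃_{≥0})² : y ≤ x}`; as a space it carries the subspace topology
of the product topology. -/
def closedOctant : Set (LongRay × LongRay) := {p | p.2 ≤ p.1}

/-- The diagonal `{(x, x)}` of the octant. -/
def octantDiagonal : Set closedOctant := {p | p.1.2 = p.1.1}

/-- The horizontal axis `{(x, 0)}` of the octant, where `0` is the least point of the long ray. -/
def octantAxis : Set closedOctant := {p | IsBot p.1.2}

/-!
# The boundary of the long octant is not collared

*Charts.* A proper initial segment of `ω₁` is countable, so positive summable lengths can be given to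
its blocks; adding them up identifies each initial segment of the long ray with an interval `[0, T)`,
hence with `[0, ∞)` (`exists_strictMonoOn_lex_Ico`, `LongRay.exists_chart`). Around each of its
points the octant therefore looks like the wedge `0 ≤ t ≤ s`, which a piecewise linear map turns into
the closed half-plane, the two sides of the wedge becoming the edge (`Octant.exists_chart`).

*Boundary.* Points off the two sides have planar neighbourhoods. For points on the sides this needs
the invariance of the boundary in dimension two: a punctured half-disc around a point of the edge is
simply connected, so a map from it to the punctured plane has a continuous logarithm, whereas a circle
in the punctured plane has none (`isEmpty_homeomorph_plane_of_half_plane_chart`).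

*Normality and collars.* Countable sets in the long ray are bounded and increasing sequences converge,
so interlaced sequences have a common limit (`LongRay.exists_leapfrog`). Two disjoint closed sets in
the octant that could not be separated would accumulate together at a point or, at infinity, along
a horizontal line or along the diagonal; in the last two cases interlaced sequences in the two sets
yield a common point (`Octant.normalSpace`). Similarly, a collar moves unboundedly many points of the
diagonal so little, at some fixed positive time, that interlacing gives a diagonal point which the
collar leaves fixed at that time (`Octant.not_isCollared`). This needs only that the collared set
contains the diagonal, so it applies both to the boundary and to the diagonal alone.
-/

/-! ### Boundary points of a half-plane have no planar neighbourhood -/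

/-- A loop running once around a circle centred at `0` has no continuous logarithm. -/
theorem not_exists_periodic_log_circle {M : ℝ → ℂ} (hM : Continuous M)
    (hper : M (2 * Real.pi) = M 0) {ε : ℝ}
    (hexp : ∀ θ : ℝ, Complex.exp (M θ) = ε * Complex.exp (θ * Complex.I)) :
    False := by
  -- `θ ↦ M θ` and `θ ↦ M 0 + iθ` are two lifts of the same loop along `exp`.
  have h0 : Complex.exp (M 0) = ε := by simpa using hexp 0
  have key : M = fun θ : ℝ => M 0 + θ * Complex.I := by
    refine Complex.isCoveringMap_exp.eq_of_comp_eq hM (by fun_prop) ?_ 0 (by simp)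
    funext θ
    simp only [Function.comp_apply, Subtype.mk.injEq]
    rw [hexp, Complex.exp_add, h0]
  have h1 := congrFun key (2 * Real.pi)
  rw [hper] at h1
  have h2 : ((2 * Real.pi : ℝ) : ℂ) * Complex.I = 0 := by
    simpa using h1.symm
  have h3 := congrArg Complex.im h2
  simp at h3

/-- Complex form of the invariance of the boundary in dimension two: a space cannot be a closed
half-plane and a plane near the same point `E 0 = φ 0`, where `0` lies on the edge of the
half-plane. The punctured half-disc has logarithmic coordinates in a convex strip, so the transition
map from it to the punctured plane has a continuous logarithm; transporting a small circle of the
plane through the half-disc then gives a continuous logarithm on that circle. -/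
theorem half_plane_chart_ne_plane_chart {X : Type*} [TopologicalSpace X]
    {E : {z : ℂ // 0 ≤ z.re} → X} (hE : IsOpenEmbedding E) {φ : ℂ → X} (hφ : IsEmbedding φ)
    (h0 : φ 0 = E ⟨0, le_rfl⟩) (hr : range φ ∈ 𝓝 (E ⟨0, le_rfl⟩)) : False := by
  obtain ⟨r, hr0, hball⟩ := Metric.mem_nhds_iff.1 (hE.continuous.continuousAt.preimage_mem_nhds hr)
  have hsub : ∀ z : {z : ℂ // 0 ≤ z.re}, ‖z.1‖ < r → E z ∈ range φ := by
    intro z hz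
    exact hball (by simpa [Metric.mem_ball, Subtype.dist_eq] using hz)
  -- Logarithmic coordinates on the half-disc of radius `r / 2`, made total by clamping.
  let c₀ : ℂ → ℂ := fun w => Complex.exp
    (((min w.re (Real.log (r / 2)) : ℝ) : ℂ) +
      ((max (-(Real.pi / 2)) (min (Real.pi / 2) w.im) : ℝ) : ℂ) * Complex.I)
  have hc₀ : Continuous c₀ := by fun_prop
  have hre : ∀ w, 0 ≤ (c₀ w).re := by
    intro w
    simp only [c₀, Complex.exp_re]
    refine mul_nonneg (Real.exp_pos _).le (Real.cos_nonneg_of_mem_Icc ?_)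
    simp only [Complex.add_im, Complex.ofReal_im, Complex.mul_im, Complex.ofReal_re, Complex.I_im,
      mul_one, Complex.I_re, mul_zero, add_zero, zero_add]
    have := Real.pi_pos
    exact ⟨le_max_left _ _, max_le (by linarith) (min_le_left _ _)⟩
  have hnorm : ∀ w, ‖c₀ w‖ < r := by
    intro w
    simp only [c₀, Complex.norm_exp]
    simp only [Complex.add_re, Complex.ofReal_re, Complex.mul_re, Complex.I_re, mul_zero,
      Complex.ofReal_im, Complex.I_im, mul_one, sub_self, add_zero]
    calc Real.exp (min w.re (Real.log (r / 2))) ≤ Real.exp (Real.log (r / 2)) :=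
          Real.exp_le_exp.2 (min_le_right _ _)
      _ = r / 2 := Real.exp_log (by positivity)
      _ < r := by linarith
  have hcne : ∀ w, c₀ w ≠ 0 := fun w => Complex.exp_ne_zero _
  have hclog : ∀ z : ℂ, z ≠ 0 → 0 ≤ z.re → ‖z‖ < r / 2 → c₀ (Complex.log z) = z := by
    intro z hz hzre hzr
    have h1 : min (Complex.log z).re (Real.log (r / 2)) = (Complex.log z).re := by
      rw [Complex.log_re]
      exact min_eq_left (Real.log_le_log (norm_pos_iff.2 hz) hzr.le)
    have h2 : max (-(Real.pi / 2)) (min (Real.pi / 2) (Complex.log z).im) = (Complex.log z).im := by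
      rw [Complex.log_im]
      have := abs_le.1 (Complex.abs_arg_le_pi_div_two_iff.2 hzre)
      rw [min_eq_right this.2, max_eq_right this.1]
    simp only [c₀]
    rw [h1, h2, Complex.re_add_im, Complex.exp_log hz]
  -- The transition map from logarithmic coordinates to the plane avoids `0`, so it has a logarithm.
  choose G hG using fun w => hsub ⟨c₀ w, hre w⟩ (hnorm w)
  have hGc : Continuous G := by
    rw [hφ.isInducing.continuous_iff]
    have : φ ∘ G = fun w => E ⟨c₀ w, hre w⟩ := funext hG
    rw [this]
    exact hE.continuous.comp (hc₀.subtype_mk _)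
  have hG0 : ∀ w, G w ≠ 0 := by
    intro w hw
    have h1 := hG w
    rw [hw, h0] at h1
    exact hcne w (congrArg Subtype.val (hE.injective h1)).symm
  obtain ⟨Λ, hΛc, hΛ⟩ := Complex.exists_continuousOn_eqOn_exp_comp (X := ℂ) (U := univ)
    ((Homeomorph.Set.univ ℂ).toHomotopyEquiv.simplyConnectedSpace_iff.2 inferInstance)
    isOpen_univ hGc.continuousOn
    (by rintro ⟨w, -, hw⟩; exact hG0 w hw)
  rw [continuousOn_univ] at hΛc
  -- A small circle of the plane, seen in the half-disc.
  have hopen : φ ⁻¹' (E '' {z | ‖z.1‖ < r / 2}) ∈ 𝓝 (0 : ℂ) := by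
    refine hφ.continuous.continuousAt.preimage_mem_nhds ?_
    rw [h0]
    refine (hE.isOpenMap _ (isOpen_lt (by fun_prop) continuous_const)).mem_nhds ?_
    exact ⟨_, by simpa using hr0, rfl⟩
  obtain ⟨ε', hε', hεball⟩ := Metric.mem_nhds_iff.1 hopen
  set ε := ε' / 2 with hεdef
  have hε : 0 < ε := by positivity
  have hex : ∀ θ : ℝ, ∃ z : {z : ℂ // 0 ≤ z.re}, ‖z.1‖ < r / 2 ∧
      E z = φ (ε * Complex.exp (θ * Complex.I)) := by
    intro θ
    have : (ε * Complex.exp (θ * Complex.I) : ℂ) ∈ Metric.ball (0 : ℂ) ε' := by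
      rw [mem_ball_zero_iff, norm_mul, Complex.norm_exp_ofReal_mul_I, mul_one, Complex.norm_real,
        Real.norm_of_nonneg hε.le]
      linarith
    obtain ⟨z, hz, hz'⟩ := hεball this
    exact ⟨z, hz, hz'⟩
  choose Z hZr hZ using hex
  have hZc : Continuous Z := by
    rw [hE.isInducing.continuous_iff]
    have : E ∘ Z = fun θ : ℝ => φ (ε * Complex.exp (θ * Complex.I)) := funext hZ
    rw [this]
    exact hφ.continuous.comp (by fun_prop)
  have hZ0 : ∀ θ, (Z θ).1 ≠ 0 := by
    intro θ h
    have h1 := hZ θ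
    rw [show Z θ = ⟨0, le_rfl⟩ from Subtype.ext h, ← h0] at h1
    have h2 := (hφ.injective h1).symm
    simp [hε.ne'] at h2
  have hslit : ∀ θ, (Z θ).1 ∈ Complex.slitPlane := by
    intro θ
    rw [Complex.mem_slitPlane_iff]
    by_contra hcon
    push Not at hcon
    exact hZ0 θ (Complex.ext (le_antisymm hcon.1 (Z θ).2) hcon.2)
  refine not_exists_periodic_log_circle (M := fun θ => Λ (Complex.log (Z θ).1)) (ε := ε) ?_ ?_ ?_
  · exact hΛc.comp ((continuous_subtype_val.comp hZc).clog hslit)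
  · have : Z (2 * Real.pi) = Z 0 := by
      apply hE.injective
      rw [hZ, hZ]
      simp [Complex.exp_two_pi_mul_I]
    simp only [this]
  · intro θ
    have h1 := hΛ (mem_univ (Complex.log (Z θ).1))
    simp only [Function.comp_apply] at h1
    rw [h1]
    apply hφ.injective
    rw [hG, ← hZ θ]
    exact congrArg E (Subtype.ext (hclog _ (hZ0 θ) (Z θ).2 (hZr θ)))

/-- Invariance of the boundary in dimension two: in a chart modelled on the closed half-plane, a
point on the edge of the half-plane has no neighbourhood homeomorphic to the plane. -/
theorem isEmpty_homeomorph_plane_of_half_plane_chart {X : Type*} [TopologicalSpace X]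
    {E : ℝ × Ici (0 : ℝ) → X} (hE : IsOpenEmbedding E) (a : ℝ) {N : Set X}
    (hN : N ∈ 𝓝 (E (a, ⟨0, self_mem_Ici⟩))) : IsEmpty (N ≃ₜ ℝ × ℝ) := by
  refine ⟨fun f => ?_⟩
  let k : {z : ℂ // 0 ≤ z.re} ≃ₜ ℝ × Ici (0 : ℝ) :=
    { toFun := fun z => (z.1.im + a, ⟨z.1.re, z.2⟩)
      invFun := fun p => ⟨⟨p.2.1, p.1 - a⟩, p.2.2⟩
      left_inv := fun z => by ext; simp
      right_inv := fun p => Prod.ext (sub_add_cancel _ _) rfl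
      continuous_toFun := by fun_prop
      continuous_invFun := by
        refine Continuous.subtype_mk ?_ _
        exact Complex.equivRealProdCLM.symm.continuous.comp
          ((continuous_subtype_val.comp continuous_snd).prodMk (continuous_fst.sub continuous_const)) }
  let q := f ⟨_, mem_of_mem_nhds hN⟩
  let m : ℂ ≃ₜ N := (Complex.equivRealProdCLM.toHomeomorph.trans (Homeomorph.addRight q)).trans f.symm
  have hk : k ⟨0, le_rfl⟩ = (a, ⟨0, self_mem_Ici⟩) := Prod.ext (by simp [k]) rfl
  refine half_plane_chart_ne_plane_chart (E := E ∘ k) (φ := Subtype.val ∘ m)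
    (hE.comp k.isOpenEmbedding) (IsEmbedding.subtypeVal.comp m.isEmbedding) ?_ ?_
  · rw [Function.comp_apply, Function.comp_apply, hk]
    simp [m, q, Prod.mk_zero_zero]
  · rw [Function.comp_apply, hk, range_comp, m.range_coe, image_univ, Subtype.range_coe]
    exact hN

/-! ### Charts of the long ray -/

section Lex

variable {I : Type*} [LinearOrder I] [WellFoundedLT I]

/-- Over a countable initial segment `Iio i` of a well-order, the lexicographic product with `[0,1)`
is order isomorphic to a real interval `[0,T)`: choose positive summable lengths `w γ` and send
`(β, t)` to `∑_{γ < β} w γ + w β * t`. -/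
theorem exists_strictMonoOn_lex_Ico {i : I} (hi : (Iio i).Countable) :
    ∃ T : ℝ, ∃ F : I ×ₗ Ico (0 : ℝ) 1 → ℝ,
      StrictMonoOn F {x | (ofLex x).1 < i} ∧ F '' {x | (ofLex x).1 < i} = Ico 0 T := by
  obtain ⟨w, hw, c, hc, -⟩ := hi.exists_pos_hasSum_le one_pos
  -- `S s` is the total length of the blocks over `s ∩ Iio i`.
  let S : Set I → ℝ := fun s => ∑' γ : Iio i, s.indicator w γ
  have hnn : ∀ (s : Set I) γ, 0 ≤ s.indicator w γ := fun s γ =>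
    indicator_nonneg (fun x _ => (hw x).le) γ
  have hsum : ∀ s : Set I, Summable fun γ : Iio i => s.indicator w γ := fun s =>
    Summable.of_nonneg_of_le (fun γ => hnn s γ)
      (fun γ => indicator_le_self' (fun x _ => (hw x).le) _) hc.summable
  have hmono : ∀ {s t : Set I}, s ⊆ t → S s ≤ S t := fun {s t} hst =>
    (hsum s).tsum_le_tsum (fun γ => indicator_le_indicator_of_subset hst (fun x => (hw x).le) _)
      (hsum t)
  have hS0 : ∀ s, 0 ≤ S s := fun s => tsum_nonneg fun γ => hnn s γ
  have hstep : ∀ β < i, S (Iic β) = S (Iio β) + w β := by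
    intro β hβ
    have h1 : ∀ γ : Iio i, (Iic β).indicator w γ =
        (Iio β).indicator w γ + (if γ = ⟨β, hβ⟩ then w β else 0) := by
      rintro ⟨γ, hγ⟩
      rcases lt_trichotomy γ β with h | rfl | h
      · have : (⟨γ, hγ⟩ : Iio i) ≠ ⟨β, hβ⟩ := fun he => h.ne (congrArg Subtype.val he)
        simp [indicator, h, h.le, this]
      · simp [indicator]
      · have : (⟨γ, hγ⟩ : Iio i) ≠ ⟨β, hβ⟩ := fun he => h.ne' (congrArg Subtype.val he)
        simp [indicator, h.not_ge, h.not_gt, this]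
    simp only [S]
    rw [tsum_congr h1, (hsum _).tsum_add, tsum_ite_eq]
    exact (hasSum_ite_eq _ _).summable
  -- Continuity at limits: `S (Iio β)` is the supremum of the `S (Iic γ)` with `γ < β`.
  have hsup : ∀ β ≤ i, ∀ x, 0 ≤ x → (∀ γ < β, S (Iic γ) ≤ x) → S (Iio β) ≤ x := by
    intro β hβ x hx h
    refine Real.tsum_le_of_sum_le (fun γ => hnn _ γ) fun F => ?_
    have h1 : ∑ γ ∈ F, (Iio β).indicator w γ = ∑ γ ∈ F with γ.1 < β, w γ := by
      rw [Finset.sum_filter]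
      exact Finset.sum_congr rfl fun γ _ => by simp [indicator]
    rw [h1]
    rcases (F.filter fun γ => γ.1 < β).eq_empty_or_nonempty with he | he
    · rw [he]; simpa using hx
    · have hmem := Finset.max'_mem _ he
      refine le_trans ?_ (h _ (Finset.mem_filter.1 hmem).2)
      calc _ = ∑ γ ∈ F with γ.1 < β,
              (Iic ((F.filter fun γ => γ.1 < β).max' he).1).indicator w γ := by
            refine Finset.sum_congr rfl fun γ hγ => ?_
            rw [indicator_of_mem]
            exact Finset.le_max' _ γ hγ
        _ ≤ _ := (hsum _).sum_le_tsum _ fun γ _ => hnn _ γ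
  have hlt : ∀ {β γ}, β < i → γ ≤ i → β < γ → ∀ t : ℝ, t < 1 → S (Iio β) + w β * t < S (Iio γ) := by
    intro β γ hβ hγ h t ht
    calc S (Iio β) + w β * t < S (Iio β) + w β := by
          have := mul_lt_mul_of_pos_left ht (hw β); linarith
      _ = S (Iic β) := (hstep β hβ).symm
      _ ≤ S (Iio γ) := hmono fun x hx => lt_of_le_of_lt hx h
  refine ⟨S (Iio i), fun x => S (Iio (ofLex x).1) + w (ofLex x).1 * (ofLex x).2.1, ?_, ?_⟩
  · intro x hx y hy hxy
    rcases Prod.Lex.lt_iff.1 hxy with h | ⟨h, h'⟩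
    · refine (hlt hx (le_of_lt hy) h _ (ofLex x).2.2.2).trans_le ?_
      exact le_add_of_nonneg_right (mul_nonneg (hw _).le (ofLex y).2.2.1)
    · have h2 := mul_lt_mul_of_pos_left (show (ofLex x).2.1 < (ofLex y).2.1 from h') (hw (ofLex x).1)
      simp only
      rw [← h]
      linarith
  · ext x
    constructor
    · rintro ⟨y, hy, rfl⟩
      exact ⟨add_nonneg (hS0 _) (mul_nonneg (hw _).le (ofLex y).2.2.1),
        hlt hy le_rfl hy _ (ofLex y).2.2.2⟩
    · rintro ⟨hx0, hxT⟩
      have hex : ∃ γ, γ < i ∧ x < S (Iic γ) := by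
        by_contra! hcon
        exact hxT.not_ge (hsup i le_rfl x hx0 hcon)
      -- The block containing `x` is the first one whose right end exceeds `x`.
      obtain ⟨β, ⟨hβi, hβ⟩, hmin⟩ :=
        wellFounded_lt.has_min {γ | γ < i ∧ x < S (Iic γ)} hex
      have hle : S (Iio β) ≤ x := by
        refine hsup β hβi.le x hx0 fun γ hγ => ?_
        by_contra! hcon
        exact hmin γ ⟨hγ.trans hβi, hcon⟩ hγ
      rw [hstep β hβi] at hβ
      refine ⟨toLex (β, ⟨(x - S (Iio β)) / w β, div_nonneg (by linarith) (hw β).le, ?_⟩), hβi, ?_⟩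
      · rw [div_lt_one (hw β)]; linarith
      · simp only [ofLex_toLex]
        rw [mul_div_cancel₀ _ (hw β).ne']
        ring

end Lex

namespace LongRay

theorem countable_Iio (i : Iio (Ordinal.omega 1 : Ordinal.{0})) : (Iio i).Countable := by
  have h : (Iio i.1).Countable := by
    rw [← Cardinal.le_aleph0_iff_set_countable, Cardinal.mk_Iio_ordinal, Cardinal.lift_le_aleph0,
      ← Cardinal.lt_aleph_one_iff]
    exact Cardinal.lt_omega_iff_card_lt.1 i.2
  exact (h.preimage Subtype.val_injective).mono fun x hx => hx

/-- The blocks visited by a sequence lie below some countable ordinal, as `ω₁` has uncountable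
cofinality. -/
theorem exists_forall_lt (x : ℕ → LongRay) : ∃ i : Iio (Ordinal.omega 1 : Ordinal.{0}),
    ∀ n, (ofLex (x n)).1 < i := by
  have h := Ordinal.iSup_lt_omega_one (f := fun n => (ofLex (x n)).1.1) fun n => (ofLex (x n)).1.2
  have hlim : Order.IsSuccLimit (Ordinal.omega 1 : Ordinal.{0}) := Cardinal.isSuccLimit_omega 1
  refine ⟨⟨_, hlim.succ_lt h⟩, fun n => ?_⟩
  rw [← Subtype.coe_lt_coe]
  exact Order.lt_succ_of_le (Ordinal.le_iSup _ n)

theorem mem_Iio_block {i : Iio (Ordinal.omega 1 : Ordinal.{0})} {x : LongRay} :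
    x ∈ Iio (toLex (i, ⟨0, by norm_num⟩) : LongRay) ↔ (ofLex x).1 < i := by
  refine Iff.trans Prod.Lex.lt_iff ⟨?_, Or.inl⟩
  rintro (h | ⟨-, h⟩)
  · exact h
  · exact absurd (show (ofLex x).2.1 < 0 from h) (ofLex x).2.2.1.not_gt

/-- Every bounded part of the long ray lies in an open initial segment isomorphic to `[0,∞)`. -/
theorem exists_chart (c : LongRay) : ∃ e : NNReal → LongRay,
    IsOpenEmbedding e ∧ StrictMono e ∧ IsLowerSet (range e) ∧ c ∈ range e := by
  obtain ⟨i, hi⟩ := exists_forall_lt fun _ => c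
  obtain ⟨T, F, hF, himg⟩ := exists_strictMonoOn_lex_Ico (countable_Iio i)
  set a : LongRay := toLex (i, ⟨0, by norm_num⟩) with ha
  have hT : ∀ x : Iio a, 0 ≤ F x.1 ∧ F x.1 < T := fun x => by
    have : F x.1 ∈ Ico 0 T := himg ▸ mem_image_of_mem F (mem_Iio_block.1 x.2)
    exact this
  -- The interval `[0,T)` is stretched to `[0,∞)` by `s ↦ s / (T - s)`.
  let G : Iio a → NNReal := fun x =>
    ⟨F x.1 / (T - F x.1), div_nonneg (hT x).1 (sub_nonneg.2 (hT x).2.le)⟩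
  have hG : StrictMono G := by
    intro x y hxy
    have h1 : F x.1 < F y.1 := hF (mem_Iio_block.1 x.2) (mem_Iio_block.1 y.2) hxy
    refine div_lt_div₀ h1 (by linarith) (hT y).1 (sub_pos.2 (hT y).2)
  have hGs : Function.Surjective G := by
    intro u
    have hc := hT ⟨c, mem_Iio_block.2 (hi 0)⟩
    have hTpos : 0 < T := hc.1.trans_lt hc.2
    have hu : 0 < 1 + (u : ℝ) := by positivity
    have : T * u / (1 + u) ∈ Ico 0 T :=
      ⟨by positivity, by rw [div_lt_iff₀ hu]; nlinarith⟩
    rw [← himg] at this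
    obtain ⟨x, hx, hxu⟩ := this
    refine ⟨⟨x, mem_Iio_block.2 hx⟩, NNReal.eq ?_⟩
    change F x / (T - F x) = u
    rw [hxu]
    have : T - T * u / (1 + u) ≠ 0 := by
      have : T - T * u / (1 + u) = T / (1 + u) := by field_simp; ring
      rw [this]
      positivity
    field_simp
    ring
  let g := hG.orderIsoOfSurjective G hGs
  refine ⟨Subtype.val ∘ g.symm, isOpen_Iio.isOpenEmbedding_subtypeVal.comp
    g.symm.toHomeomorph.isOpenEmbedding, fun x y h => g.symm.strictMono h, ?_, ?_⟩
  · rw [range_comp, g.symm.surjective.range_eq, image_univ, Subtype.range_coe]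
    exact isLowerSet_Iio a
  · rw [range_comp, g.symm.surjective.range_eq, image_univ, Subtype.range_coe]
    exact mem_Iio_block.2 (hi 0)

/-- Every countable set of points of the long ray is strictly bounded above. -/
theorem exists_lt_of_countable {ι : Type*} [Countable ι] (x : ι → LongRay) :
    ∃ a : LongRay, ∀ n, x n < a := by
  rcases isEmpty_or_nonempty ι with h | h
  · exact ⟨toLex (⟨0, Ordinal.omega_pos 1⟩, ⟨0, by norm_num⟩), fun n => h.elim n⟩
  · obtain ⟨f, hf⟩ := exists_surjective_nat ι
    obtain ⟨i, hi⟩ := exists_forall_lt (x ∘ f)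
    refine ⟨toLex (i, ⟨0, by norm_num⟩), fun n => ?_⟩
    obtain ⟨k, rfl⟩ := hf n
    exact mem_Iio_block.2 (hi k)

instance : NoMaxOrder LongRay := ⟨fun a => by
  obtain ⟨b, hb⟩ := exists_lt_of_countable fun _ : Unit => a
  exact ⟨b, hb ()⟩⟩

instance : Nonempty LongRay := ⟨toLex (⟨0, Ordinal.omega_pos 1⟩, ⟨0, by norm_num⟩)⟩

theorem isCompact_Iic (c : LongRay) : IsCompact (Iic c) := by
  obtain ⟨e, he, hmono, hlow, s, rfl⟩ := exists_chart c
  have : Iic (e s) = e '' Icc 0 s := by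
    ext x
    constructor
    · intro hx
      obtain ⟨t, rfl⟩ := hlow hx ⟨s, rfl⟩
      exact ⟨t, ⟨zero_le, hmono.le_iff_le.1 hx⟩, rfl⟩
    · rintro ⟨t, ht, rfl⟩
      exact hmono.monotone ht.2
  rw [this]
  exact isCompact_Icc.image he.continuous

/-- The bottom of a chart is the least element of the long ray. -/
theorem isBot_iff_of_chart {e : NNReal → LongRay} (hmono : StrictMono e)
    (hlow : IsLowerSet (range e)) {t : NNReal} : IsBot (e t) ↔ t = 0 := by
  constructor
  · intro h
    exact le_antisymm (hmono.le_iff_le.1 (h (e 0))) zero_le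
  · rintro rfl x
    rcases le_total (e 0) x with h | h
    · exact h
    · obtain ⟨s, rfl⟩ := hlow h ⟨0, rfl⟩
      exact hmono.monotone zero_le

theorem exists_tendsto_of_monotone {x : ℕ → LongRay} (hx : Monotone x) :
    ∃ l : LongRay, Filter.Tendsto x Filter.atTop (𝓝 l) := by
  obtain ⟨c, hc⟩ := exists_lt_of_countable x
  obtain ⟨e, he, hmono, hlow, s, rfl⟩ := exists_chart c
  choose u hu using fun n => hlow (hc n).le ⟨s, rfl⟩
  have humono : Monotone u := fun m n h => by
    rw [← hmono.le_iff_le, hu, hu]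
    exact hx h
  have hbdd : BddAbove (range u) := ⟨s, by
    rintro _ ⟨n, rfl⟩
    rw [← hmono.le_iff_le, hu]
    exact (hc n).le⟩
  refine ⟨e (⨆ n, u n), ?_⟩
  rw [show x = e ∘ u from (funext hu).symm]
  exact (he.continuous.tendsto _).comp (tendsto_atTop_ciSup humono hbdd)

/-- The leapfrog principle: for any functions `f n` of the long ray there is an increasing sequence
`c` with `f n (c n) ≤ c (n + 1)`. Hence all sequences interlaced with it, in the sense that
`c n ≤ z n ≤ f n (c n)`, converge to one and the same point. -/
theorem exists_leapfrog (f : ℕ → LongRay → LongRay) : ∃ c : ℕ → LongRay, ∃ l : LongRay,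
    ∀ z : ℕ → LongRay, (∀ n, c n ≤ z n) → (∀ n, z n ≤ f n (c n)) →
      Filter.Tendsto z Filter.atTop (𝓝 l) := by
  let c : ℕ → LongRay := fun n =>
    n.rec (Classical.arbitrary LongRay) fun n a => max a (f n a)
  have hc : ∀ n, c (n + 1) = max (c n) (f n (c n)) := fun n => rfl
  obtain ⟨l, hl⟩ := exists_tendsto_of_monotone
    (monotone_nat_of_le_succ fun n => (hc n).symm ▸ le_max_left _ _)
  exact ⟨c, l, fun z h1 h2 => tendsto_of_tendsto_of_tendsto_of_le_of_le hl
    (hl.comp (Filter.tendsto_add_atTop_nat 1)) h1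
    fun n => (h2 n).trans ((le_max_right _ _).trans (hc n).symm.le)⟩

instance : FirstCountableTopology LongRay := ⟨fun c => by
  obtain ⟨e, he, -, -, s, rfl⟩ := exists_chart c
  rw [← he.map_nhds_eq]
  infer_instance⟩

/-- An ultrafilter on the long ray either converges or escapes to infinity. -/
theorem ultrafilter_le_nhds_or (U : Ultrafilter LongRay) :
    (∃ a, (U : Filter LongRay) ≤ 𝓝 a) ∨ ∀ c, Ici c ∈ U := by
  by_cases h : ∀ c, Ici c ∈ U
  · exact Or.inr h
  · push Not at h
    obtain ⟨c, hc⟩ := h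
    have hc' : Iic c ∈ U := by
      refine Filter.mem_of_superset (Ultrafilter.compl_mem_iff_notMem.2 hc) fun x hx => ?_
      exact (not_le.1 (show ¬ c ≤ x from hx)).le
    obtain ⟨a, -, ha⟩ := (isCompact_Iic c).ultrafilter_le_nhds' U hc'
    exact Or.inl ⟨a, ha⟩

end LongRay

/-! ### Charts of the octant -/

namespace Octant

/-- The closed half-plane is homeomorphic to the wedge `{(s, t) : 0 ≤ t ≤ s}`, by a piecewise linear
map which takes the edge to the two sides of the wedge. -/
noncomputable def wedgeHomeo : ℝ × Ici (0 : ℝ) ≃ₜ {p : NNReal × NNReal | p.2 ≤ p.1} where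
  toFun q := ⟨(⟨2 * q.2.1 + |q.1|, add_nonneg (mul_nonneg two_pos.le q.2.2) (abs_nonneg _)⟩,
      ⟨q.2.1 + max (-q.1) 0, add_nonneg q.2.2 (le_max_right _ _)⟩), by
    change q.2.1 + max (-q.1) 0 ≤ 2 * q.2.1 + |q.1|
    have h1 : 0 ≤ q.2.1 := q.2.2
    have h2 : max (-q.1) 0 ≤ |q.1| := max_le (neg_le_abs _) (abs_nonneg _)
    linarith⟩
  invFun p := (p.1.1 - 2 * p.1.2, ⟨min (p.1.1 - p.1.2 : ℝ) p.1.2,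
    le_min (sub_nonneg.2 p.2) p.1.2.2⟩)
  left_inv q := by
    obtain ⟨x, m, hm⟩ := q
    refine Prod.ext ?_ (Subtype.ext ?_)
    · change (2 * m + |x|) - 2 * (m + max (-x) 0) = x
      rcases le_total 0 x with h | h
      · rw [abs_of_nonneg h, max_eq_right (by linarith)]; ring
      · rw [abs_of_nonpos h, max_eq_left (by linarith)]; ring
    · change min ((2 * m + |x|) - (m + max (-x) 0)) (m + max (-x) 0) = m
      rcases le_total 0 x with h | h
      · rw [abs_of_nonneg h, max_eq_right (by linarith), min_eq_right (by linarith)]; ring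
      · rw [abs_of_nonpos h, max_eq_left (by linarith), min_eq_left (by linarith)]; ring
  right_inv p := by
    obtain ⟨⟨s, t⟩, h⟩ := p
    have h : (t : ℝ) ≤ s := h
    refine Subtype.ext (Prod.ext (NNReal.eq ?_) (NNReal.eq ?_))
    · change 2 * min (s - t : ℝ) t + |(s : ℝ) - 2 * t| = s
      rcases le_total 0 ((s : ℝ) - 2 * t) with h | h
      · rw [abs_of_nonneg h, min_eq_right (by linarith)]; ring
      · rw [abs_of_nonpos h, min_eq_left (by linarith)]; ring
    · change min (s - t : ℝ) t + max (-((s : ℝ) - 2 * t)) 0 = t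
      rcases le_total 0 ((s : ℝ) - 2 * t) with h | h
      · rw [max_eq_right (by linarith), min_eq_right (by linarith)]; ring
      · rw [max_eq_left (by linarith), min_eq_left (by linarith)]; ring
  continuous_toFun := by fun_prop
  continuous_invFun := by fun_prop

/-- The edge of the half-plane corresponds to the two sides of the wedge. -/
theorem wedgeHomeo_mem_sides {q : ℝ × Ici (0 : ℝ)} :
    ((wedgeHomeo q).1.2 = (wedgeHomeo q).1.1 ∨ (wedgeHomeo q).1.2 = 0) ↔ q.2.1 = 0 := by
  obtain ⟨⟨⟨s, t⟩, h⟩, rfl⟩ := wedgeHomeo.symm.surjective q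
  have h : (t : ℝ) ≤ s := h
  rw [wedgeHomeo.apply_symm_apply]
  change (t = s ∨ t = 0) ↔ min (s - t : ℝ) t = 0
  rw [← NNReal.coe_inj, ← NNReal.coe_inj, NNReal.coe_zero]
  have ht : (0 : ℝ) ≤ t := t.2
  constructor
  · rintro (h' | h')
    · rw [h', sub_self]; exact min_eq_left (by linarith)
    · rw [h']; exact min_eq_right (by linarith)
  · intro h'
    rcases min_choice (s - t : ℝ) t with h'' | h''
    · left; linarith
    · right; linarith

/-- Every point of the octant lies in an open set homeomorphic to the closed half-plane, the edge of
which is the part of the diagonal and of the axis in that set. -/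
theorem exists_chart (p : closedOctant) : ∃ E : ℝ × Ici (0 : ℝ) → closedOctant,
    IsOpenEmbedding E ∧ p ∈ range E ∧ ∀ q, E q ∈ octantDiagonal ∪ octantAxis ↔ q.2.1 = 0 := by
  obtain ⟨e, he, hmono, hlow, s, hs⟩ := LongRay.exists_chart p.1.1
  obtain ⟨t, ht⟩ := hlow p.2 ⟨s, hs⟩
  have hset : {p : NNReal × NNReal | p.2 ≤ p.1} = Prod.map e e ⁻¹' closedOctant := by
    ext p
    exact hmono.le_iff_le.symm
  let k := wedgeHomeo.trans (Homeomorph.setCongr hset)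
  refine ⟨closedOctant.restrictPreimage (Prod.map e e) ∘ k,
    ((he.prodMap he).restrictPreimage closedOctant).comp k.isOpenEmbedding, ?_, fun q => ?_⟩
  · have hst : (s, t) ∈ Prod.map e e ⁻¹' closedOctant := by
      change e t ≤ e s
      rw [hs, ht]
      exact p.2
    obtain ⟨q, hq⟩ := k.surjective ⟨(s, t), hst⟩
    refine ⟨q, Subtype.ext ?_⟩
    rw [Function.comp_apply, hq]
    exact Prod.ext hs ht
  · rw [← wedgeHomeo_mem_sides]
    refine or_congr ?_ ?_
    · exact hmono.injective.eq_iff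
    · exact LongRay.isBot_iff_of_chart hmono hlow

theorem isSurface : IsSurface closedOctant := by
  refine ⟨inferInstance, fun p => ?_⟩
  obtain ⟨E, hE, hp, -⟩ := exists_chart p
  exact ⟨range E, hE.isOpen_range.mem_nhds hp, ⟨hE.isEmbedding.toHomeomorph.symm⟩⟩

theorem surfaceBoundary_eq : surfaceBoundary closedOctant = octantDiagonal ∪ octantAxis := by
  ext p
  obtain ⟨E, hE, ⟨⟨x, m⟩, rfl⟩, hB⟩ := exists_chart p
  rw [hB]
  constructor
  · intro h
    by_contra hm
    have hm : 0 < m.1 := lt_of_le_of_ne m.2 (Ne.symm hm)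
    -- Off the edge, the plane `ℝ × ℝ` is embedded as the open half-plane through `exp`.
    let j : ℝ × ℝ → ℝ × Ici (0 : ℝ) := fun q => (q.1, ⟨Real.exp q.2, (Real.exp_pos _).le⟩)
    have hj : IsOpenEmbedding j := by
      refine IsOpenEmbedding.id.prodMap
        (g := fun y : ℝ => (⟨Real.exp y, (Real.exp_pos _).le⟩ : Ici (0 : ℝ))) ?_
      refine .of_continuous_injective_isOpenMap (by fun_prop)
        (fun a b h => Real.exp_injective (congrArg Subtype.val h)) ?_
      intro V hV
      have := Real.isOpenEmbedding_exp.isOpenMap V hV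
      convert this.preimage (continuous_subtype_val (p := (· ∈ Ici (0:ℝ)))) using 1
      ext y
      simp [Subtype.ext_iff]
    refine h ⟨range (E ∘ j), (hE.comp hj).isOpen_range.mem_nhds ?_,
      ⟨(hE.comp hj).isEmbedding.toHomeomorph.symm⟩⟩
    exact ⟨(x, Real.log m), congrArg E (Prod.ext rfl (Subtype.ext (Real.exp_log hm)))⟩
  · rintro hm ⟨N, hN, ⟨f⟩⟩
    obtain rfl : m = ⟨0, self_mem_Ici⟩ := Subtype.ext hm
    exact (isEmpty_homeomorph_plane_of_half_plane_chart hE x hN).false f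

/-! ### Normality of the octant -/

/-- A closed set `A` of the octant contains all limits of its sequences, computed coordinatewise. -/
theorem exists_mem_of_tendsto {A : Set closedOctant} (hA : IsClosed A) {z : ℕ → closedOctant}
    (hz : ∀ n, z n ∈ A) {a b : LongRay}
    (ha : Filter.Tendsto (fun n => (z n).1.1) Filter.atTop (𝓝 a))
    (hb : Filter.Tendsto (fun n => (z n).1.2) Filter.atTop (𝓝 b)) : ∃ p ∈ A, p.1 = (a, b) := by
  have hab : b ≤ a := le_of_tendsto_of_tendsto' hb ha fun n => (z n).2
  exact ⟨⟨(a, b), hab⟩, hA.mem_of_tendsto (tendsto_subtype_rng.2 (ha.prodMk_nhds hb))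
    (Filter.Eventually.of_forall hz), rfl⟩

/-- If closed sets `A` and `B` could not be separated, some ultrafilter `U` would refine both
neighbourhood filters. If `U` converges, its limit lies in `A ∩ B`. Otherwise `U` escapes to infinity
along a horizontal line or in both coordinates, and leapfrogging between `A` and `B` produces
a common limit point. -/
instance normalSpace : NormalSpace closedOctant where
  normal A B hA hB hAB := by
    rw [separatedNhds_iff_disjoint]
    by_contra hcon
    rw [disjoint_iff, ← ne_eq, ← Filter.neBot_iff] at hcon
    let U := Ultrafilter.of (𝓝ˢ A ⊓ 𝓝ˢ B)
    have hUA : (U : Filter closedOctant) ≤ 𝓝ˢ A := (Ultrafilter.of_le _).trans inf_le_left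
    have hUB : (U : Filter closedOctant) ≤ 𝓝ˢ B := (Ultrafilter.of_le _).trans inf_le_right
    have hmeet : ∀ {C : Set closedOctant}, (U : Filter closedOctant) ≤ 𝓝ˢ C → ∀ {K}, IsClosed K →
        K ∈ U → (K ∩ C).Nonempty := by
      intro C hC K hK hKU
      by_contra hne
      rw [not_nonempty_iff_eq_empty, ← disjoint_iff_inter_eq_empty] at hne
      have h1 : Kᶜ ∈ 𝓝ˢ C := hK.isOpen_compl.mem_nhdsSet.2 hne.subset_compl_left
      exact Ultrafilter.compl_mem_iff_notMem.1 (hC h1) hKU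
    have hfst : Continuous fun p : closedOctant => p.1.1 := by fun_prop
    have hsnd : Continuous fun p : closedOctant => p.1.2 := by fun_prop
    rcases LongRay.ultrafilter_le_nhds_or (U.map fun p => p.1.2) with ⟨b, hb⟩ | hinf₂
    · have hb : Filter.Tendsto (fun p : closedOctant => p.1.2) U (𝓝 b) := hb
      rcases LongRay.ultrafilter_le_nhds_or (U.map fun p => p.1.1) with ⟨a, ha⟩ | hinf₁
      · -- Both coordinates converge.
        have ha : Filter.Tendsto (fun p : closedOctant => p.1.1) U (𝓝 a) := ha
        have hab : b ≤ a := le_of_tendsto_of_tendsto' hb ha fun p => p.2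
        have hlim : (U : Filter closedOctant) ≤ 𝓝 ⟨(a, b), hab⟩ :=
          Filter.tendsto_id'.1 (tendsto_subtype_rng.2 (ha.prodMk_nhds hb))
        have hmem : ∀ {C : Set closedOctant}, IsClosed C → (U : Filter closedOctant) ≤ 𝓝ˢ C →
            (⟨(a, b), hab⟩ : closedOctant) ∈ C := by
          intro C hC hUC
          by_contra hnot
          obtain ⟨K, hK, hKc, hKC⟩ := exists_mem_nhds_isClosed_subset (hC.isOpen_compl.mem_nhds hnot)
          obtain ⟨x, hxK, hxC⟩ := hmeet hUC hKc (hlim hK)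
          exact hKC hxK hxC
        exact disjoint_left.1 hAB (hmem hA hUA) (hmem hB hUB)
      · -- The first coordinate escapes along a horizontal line.
        obtain ⟨V, hV⟩ := (𝓝 b).exists_antitone_basis
        have hpick : ∀ {C : Set closedOctant}, (U : Filter closedOctant) ≤ 𝓝ˢ C →
            ∀ (n : ℕ) (c : LongRay), ∃ p ∈ C, c ≤ p.1.1 ∧ p.1.2 ∈ V n := by
          intro C hC n c
          obtain ⟨K, hK, hKc, hKV⟩ := exists_mem_nhds_isClosed_subset (hV.1.mem_of_mem (i := n) trivial)
          obtain ⟨p, ⟨hp1, hp2⟩, hpC⟩ := hmeet hC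
            ((isClosed_Ici.preimage hfst).inter (hKc.preimage hsnd))
            (Filter.inter_mem (hinf₁ c) (hb hK))
          exact ⟨p, hpC, hp1, hKV hp2⟩
        choose α hα hα₁ hα₂ using hpick hUA
        choose β hβ hβ₁ hβ₂ using hpick hUB
        obtain ⟨c, l, hl⟩ := LongRay.exists_leapfrog fun n a => max (α n a).1.1 (β n a).1.1
        obtain ⟨p, hp, hp'⟩ := exists_mem_of_tendsto hA (fun n => hα n (c n))
          (hl _ (fun n => hα₁ n _) fun n => le_max_left _ _) (hV.tendsto fun n => hα₂ n _)
        obtain ⟨q, hq, hq'⟩ := exists_mem_of_tendsto hB (fun n => hβ n (c n))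
          (hl _ (fun n => hβ₁ n _) fun n => le_max_right _ _) (hV.tendsto fun n => hβ₂ n _)
        exact disjoint_left.1 hAB hp (Subtype.ext (hp'.trans hq'.symm) ▸ hq)
    · -- Both coordinates escape, since the second is at most the first.
      have hpick : ∀ {C : Set closedOctant}, (U : Filter closedOctant) ≤ 𝓝ˢ C →
          ∀ c : LongRay, ∃ p ∈ C, c ≤ p.1.2 := by
        intro C hC c
        obtain ⟨p, hp, hpC⟩ := hmeet hC (isClosed_Ici.preimage hsnd) (hinf₂ c)
        exact ⟨p, hpC, hp⟩
      choose α hα hα₂ using hpick hUA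
      choose β hβ hβ₂ using hpick hUB
      obtain ⟨c, l, hl⟩ := LongRay.exists_leapfrog fun _ a => max (α a).1.1 (β a).1.1
      obtain ⟨p, hp, hp'⟩ := exists_mem_of_tendsto hA (fun n => hα (c n))
        (hl _ (fun n => (hα₂ _).trans (α _).2) fun n => le_max_left _ _)
        (hl _ (fun n => hα₂ _) fun n => (α _).2.trans (le_max_left _ _))
      obtain ⟨q, hq, hq'⟩ := exists_mem_of_tendsto hB (fun n => hβ (c n))
        (hl _ (fun n => (hβ₂ _).trans (β _).2) fun n => le_max_right _ _)
        (hl _ (fun n => hβ₂ _) fun n => (β _).2.trans (le_max_right _ _))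
      exact disjoint_left.1 hAB hp (Subtype.ext (hp'.trans hq'.symm) ▸ hq)

/-! ### Sets containing the diagonal are not collared -/

/-- Let `h` be a collar. For each `c` there are a diagonal point `x` beyond `c` and a time
`1 / (n + 1)` at which both coordinates of `h (x, 1 / (n + 1))` are still beyond `c`. By countability
one `n` serves for all `c`. Leapfrogging gives a diagonal point that is fixed at the positive time
`1 / (n + 1)`, whereas a collar meets `B` only at time `0`. -/
theorem not_isCollared {B : Set closedOctant} (hB : octantDiagonal ⊆ B) : ¬ IsCollared B := by
  rintro ⟨h, hemb, h0, hpre, -⟩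
  have hc := hemb.continuous
  let d : LongRay → B := fun x => ⟨⟨(x, x), le_refl x⟩, hB rfl⟩
  have hd : Continuous d := by fun_prop
  let τ : ℕ → Icc (0 : ℝ) 1 := fun n => ⟨1 / (n + 1), by positivity, by
    rw [div_le_one (by positivity)]
    have : (0 : ℝ) ≤ n := n.cast_nonneg
    linarith⟩
  have hτ : Filter.Tendsto τ Filter.atTop (𝓝 ⟨0, by norm_num⟩) :=
    tendsto_subtype_rng.2 tendsto_one_div_add_atTop_nhds_zero_nat
  have hτ0 : ∀ n, ((τ n : Icc (0 : ℝ) 1) : ℝ) ≠ 0 := fun n => by positivity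
  have hex : ∀ c : LongRay, ∃ n x, c < x ∧ c < (h (d x, τ n)).1.2 := by
    intro c
    obtain ⟨x, hx⟩ := exists_gt c
    have h1 : Filter.Tendsto (fun n => (h (d x, τ n)).1.2) Filter.atTop (𝓝 x) := by
      have h2 : Continuous fun t => (h (d x, t)).1.2 := by fun_prop
      have h3 := (h2.tendsto ⟨0, by norm_num⟩).comp hτ
      rw [h0 (d x)] at h3
      exact h3
    obtain ⟨n, hn⟩ := (h1.eventually (lt_mem_nhds hx)).exists
    exact ⟨n, x, hx, hn⟩
  obtain ⟨n, hn⟩ : ∃ n, ∀ c : LongRay, ∃ x, c < x ∧ c < (h (d x, τ n)).1.2 := by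
    by_contra! hcon
    choose c hc using hcon
    obtain ⟨a, ha⟩ := LongRay.exists_lt_of_countable c
    obtain ⟨n, x, hx, hx'⟩ := hex a
    exact ((ha n).trans hx').not_ge (hc n x ((ha n).trans hx))
  choose X hX hX' using hn
  obtain ⟨c, l, hl⟩ := LongRay.exists_leapfrog fun _ a => max (X a) (h (d (X a), τ n)).1.1
  have hXl := hl (fun k => X (c k)) (fun k => (hX _).le) fun k => le_max_left _ _
  have h₁ := hl (fun k => (h (d (X (c k)), τ n)).1.1)
    (fun k => (hX' _).le.trans (h (d (X (c k)), τ n)).2) fun k => le_max_right _ _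
  have h₂ := hl (fun k => (h (d (X (c k)), τ n)).1.2) (fun k => (hX' _).le)
    fun k => (h (d (X (c k)), τ n)).2.trans (le_max_right _ _)
  have hlim : Filter.Tendsto (fun k => (h (d (X (c k)), τ n)).1) Filter.atTop
      (𝓝 (h (d l, τ n)).1) := by
    have : Continuous fun x => (h (d x, τ n)).1 := by fun_prop
    exact (this.tendsto l).comp hXl
  have hfix : (h (d l, τ n)).1 = (l, l) := tendsto_nhds_unique hlim (h₁.prodMk_nhds h₂)
  have hmem : (d l, τ n) ∈ h ⁻¹' B := hB (show (h (d l, τ n)).1.2 = (h (d l, τ n)).1.1 by rw [hfix])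
  rw [hpre] at hmem
  exact hτ0 n hmem

end Octant

theorem mainTheorem6 :
    IsSurface closedOctant ∧
    T4Space closedOctant ∧
    surfaceBoundary closedOctant = octantDiagonal ∪ octantAxis ∧
    ¬ IsCollared (surfaceBoundary closedOctant) ∧
    ¬ IsCollared octantDiagonal := by
  refine ⟨Octant.isSurface, {}, Octant.surfaceBoundary_eq, ?_, Octant.not_isCollared subset_rfl⟩
  rw [Octant.surfaceBoundary_eq]
  exact Octant.not_isCollared subset_union_left
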